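/- Problems are partial multifunctions $f:\subseteq\mathbb{N}^{\mathbb{N}}\rightrightarrows\mathbb{N}^{\mathbb{N}}$. A partial function $F:\subseteq\mathbb{N}^{\mathbb{N}}\to\mathbb{N}^{\mathbb{N}}$ realizes $f$ if $F(x)$ is defined and $F(x)\in f(x)$ for all $x\in\operatorname{dom}(f)$. A problem $g$ is Weihrauch reducible to $f$, written $g\leq_{\mathrm W} f$, if there are computable partial functionals $H,K:\subseteq\mathbb{N}^{\mathbb{N}}\to\mathbb{N}^{\mathbb{N}}$ such that $K\langle FH,\mathrm{id}\rangle$ realizes $g$ whenever $F$ realizes $f$; and $f\equiv_{\mathrm W} g$ means $f\leq_{\mathrm W} g$ and $g\leq_{\mathrm W} f$. Finite and countable data (numbers, colourings of $\mathbb{N}$ or of $\mathbb{Q}$, pairs of these) are coded by elements of $\mathbb{N}^{\mathbb{N}}$ in the standard way, and $k\in\mathbb{N}$ is identified with $\{0,\dots,k-1\}$. Let $\mathsf{cRT}^1_k$ be the problem whose inputs are the sequences $p\in k^{\mathbb{N}}$ and whose solutions for $p$ are the $j<k$ that occur infinitely often in $p$, and let $\mathsf{cRT}^1_+=\bigsqcup_{k>0}\mathsf{cRT}^1_k$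 be the disjoint union of these problems: an input is a pair $(k,p)$ with $k>0$ and $p\in k^{\mathbb{N}}$, and its solutions are the pairs $(k,j)$ with $j$ a solution of $\mathsf{cRT}^1_k$ for $p$. Let $\mathsf{c}(\eta)^1_{<\infty}$ be the problem whose inputs are the pairs $(k,\alpha)$ with $k\in\mathbb{N}$ and $\alpha:\mathbb{Q}\to k$, and whose solutions for $(k,\alpha)$ are the colours $c<k$ for which there are rationals $u<v$ such that $\alpha^{-1}(c)$ is dense in the interval $]u,v[$, i.e. for all rationals $x<y$ in $]u,v[$ there is a rational $z$ with $x<z<y$ and $\alpha(z)=c$. Let $(\mathsf{c}(\eta)^1_{<\infty})_k$ be the restriction of $\mathsf{c}(\eta)^1_{<\infty}$ to inputs whose number of colours is $k$. Then $(\mathsf{c}(\eta)^1_{<\infty})_k\equiv_{\mathrm W}\mathsf{cRT}^1_k$ for every $k\in\mathbb{N}$, and $\mathsf{c}(\eta)^1_{<\infty}\equiv_{\mathrm W}\mathsf{cRT}^1_+$. -/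

import Mathlib

namespace Weihrauch

/-- Baire space `ℕ^ℕ`; its elements serve as names of infinite objects. -/
abbrev Baire : Type := ℕ → ℕ

/-- A problem: a partial multifunction `ℕ^ℕ ⇉ ℕ^ℕ`, given by its sets of solutions. -/
abbrev Problem : Type := Baire → Set Baire

/-- The domain of a problem: the inputs that have a solution. -/
def Problem.dom (f : Problem) : Set Baire := {x | (f x).Nonempty}

/-- The finite initial segment `p(0), …, p(n-1)` of `p`. -/
def initSeg (p : Baire) (n : ℕ) : List ℕ := (List.range n).map p

/-- A partial functional `Φ : ⊆ ℕ^ℕ → ℕ^ℕ` is computable if there is a computable function `f` on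
finite words, monotone for the order "is an initial segment of", such that for every `p` in the
domain of `Φ` the words `f (p(0), …, p(n-1))` converge to `Φ p` as `n → ∞`: each entry of `Φ p`
is eventually produced (and, by monotonicity, never revised). -/
def ComputableFunctional (Φ : Baire →. Baire) : Prop :=
  ∃ f : List ℕ → List ℕ, Computable f ∧ (∀ u v : List ℕ, u <+: v → f u <+: f v) ∧
    ∀ p : Baire, ∀ q ∈ Φ p, ∀ m : ℕ, ∃ n : ℕ, (f (initSeg p n))[m]? = some (q m)

/-- `F` is a realizer of `f`: on every `x ∈ dom f`, `F x` is defined and `F x ∈ f x`. -/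
def Realizes (F : Baire →. Baire) (f : Problem) : Prop :=
  ∀ x ∈ f.dom, ∃ y ∈ F x, y ∈ f x

/-- The pairing `⟨p, q⟩ = p(0) q(0) p(1) q(1) …` on Baire space. -/
def pairing (p q : Baire) : Baire := fun n => if n % 2 = 0 then p (n / 2) else q (n / 2)

/-- The partial function `K ⟨F H, id⟩`. -/
def wrap (H K F : Baire →. Baire) : Baire →. Baire :=
  fun x => (H x).bind fun z => (F z).bind fun y => K (pairing y x)

/-- `Reducible g f`: the problem `g` is Weihrauch reducible to the problem `f`. -/
def Reducible (g f : Problem) : Prop :=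
  ∃ H K : Baire →. Baire, ComputableFunctional H ∧ ComputableFunctional K ∧
    ∀ F : Baire →. Baire, Realizes F f → Realizes (wrap H K F) g

/-- Weihrauch equivalence of two problems. -/
def Equivalent (f g : Problem) : Prop := Reducible f g ∧ Reducible g f

/-- `p` with its first entry removed; the sequence `p(0) p(1) p(2) …` is also read as the pair
of the number `p(0)` and the sequence `tail p`. -/
def tail (p : Baire) : Baire := fun n => p (n + 1)

/-- The disjoint union of the problems `f i`, `i ∈ S`: inputs are the pairs `(i, x)` with `i ∈ S`
and `x ∈ dom (f i)`, and the solutions are the pairs `(i, y)` with `y ∈ f i x`. -/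
def disjointUnion (S : Set ℕ) (f : ℕ → Problem) : Problem :=
  fun p => {r | p 0 ∈ S ∧ r 0 = p 0 ∧ tail r ∈ f (p 0) (tail p)}

/-- The problem `cRT¹_k`: given `p ∈ k^ℕ`, find some `j < k` that occurs infinitely often in `p`.
A number `j` is named by any sequence with first entry `j`. -/
def cRT (k : ℕ) : Problem :=
  fun p => {r | (∀ n, p n < k) ∧ r 0 < k ∧ {n | p n = r 0}.Infinite}

/-- The problem `cRT¹_+`, the disjoint union of `cRT¹_k` over `k > 0`. -/
def cRTPlus : Problem := disjointUnion {k | 0 < k} cRT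

/-- The standard enumeration of the rationals, `⟨⟨a, b⟩, c⟩ ↦ (a - b) / (c + 1)`. -/
def ratEnum (n : ℕ) : ℚ :=
  ((n.unpair.1.unpair.1 : ℚ) - (n.unpair.1.unpair.2 : ℚ)) / ((n.unpair.2 : ℚ) + 1)

/-- The colour `c` occurs densely in the interval `]u, v[`: strictly between any two points of
`]u, v[` there is a rational of colour `c`. -/
def OccursDensely {k : ℕ} (α : ℚ → Fin k) (c : Fin k) (u v : ℚ) : Prop :=
  ∀ x ∈ Set.Ioo u v, ∀ y ∈ Set.Ioo u v, x < y → ∃ z, x < z ∧ z < y ∧ α z = c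

/-- `p` is the name of the pair of the number `k` and the colouring `α : ℚ → k`. -/
def NamesColouring (p : Baire) (k : ℕ) (α : ℚ → Fin k) : Prop :=
  p 0 = k ∧ ∀ n, tail p n = (α (ratEnum n) : ℕ)

/-- The problem `c(η)¹_{<∞}`: given `k` and `α : ℚ → k`, find a colour that occurs densely
in some interval `]u, v[` with rational endpoints `u < v`. -/
def cEta : Problem :=
  fun p => {r | ∃ (k : ℕ) (α : ℚ → Fin k), NamesColouring p k α ∧
    ∃ c : Fin k, r 0 = (c : ℕ) ∧ ∃ u v : ℚ, u < v ∧ OccursDensely α c u v}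

/-- The problem `(c(η)¹_{<∞})_k`, the restriction of `c(η)¹_{<∞}` to `k`-colourings. -/
def cEtaRestrict (k : ℕ) : Problem := fun p => {r | p 0 = k ∧ r ∈ cEta p}

end Weihrauch

/-! To solve `cEta` with `cRT`, list the rational intervals, each infinitely often, and shrink a set
X of rationals, starting from all of ℚ: cut X down to the next interval whenever the intersection is
nonempty and shows fewer colours. With finitely many colours this happens finitely often
(`exists_limitSet_stable`). The final X is open and nonempty, and each of its colours occurs in
every interval that meets X within X (`exists_limitSet_recurrent`), so each is a solution. X is not
computable, but any fixed number of stages is simulated correctly on all large finite samples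
(`eventually_narrowed_eq`). Hence the computable sequence of guesses eventually takes only colours
of X. It need not converge; `cRT` picks a value that recurs, and that value is a solution.

Conversely, colour a rational by the entry of `p` at its least index. A colour dense in an interval
occurs at infinitely many rationals, hence at infinitely many indices of `p`. -/

namespace Weihrauch

open Filter

/-! ### Computable functionals and reductions -/

/-- The total functional whose `s`-th output is computed by `G` from the first `s + c` inputs. -/
def prefixFunctional (G : List ℕ → ℕ) (c : ℕ) (p : Baire) : Baire :=
  fun s => G (initSeg p (s + c))

theorem length_initSeg (p : Baire) (n : ℕ) : (initSeg p n).length = n := by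
  simp [initSeg]

theorem getD_initSeg (p : Baire) {i n : ℕ} (h : i < n) : (initSeg p n).getD i 0 = p i := by
  simp [initSeg, List.getD, h]

theorem computableFunctional_prefixFunctional {G : List ℕ → ℕ} (hG : Primrec G) (c : ℕ) :
    ComputableFunctional fun p => Part.some (prefixFunctional G c p) := by
  -- The outputs `s` determined by `u` are those with `s + c ≤ u.length`.
  refine ⟨fun u => (List.range (u.length + 1 - c)).map fun s => G (u.take (s + c)), ?_, ?_, ?_⟩
  · apply Primrec.to_comp
    refine Primrec.list_map (Primrec.list_range.comp ?_) ?_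
    · exact Primrec.nat_sub.comp (Primrec.succ.comp Primrec.list_length) (Primrec.const c)
    · exact hG.comp (Primrec.list_take.comp
        (Primrec.nat_add.comp Primrec.snd (Primrec.const c)) Primrec.fst)
  · rintro u v huv
    have hlen := huv.length_le
    rw [List.prefix_iff_getElem?]
    intro i hi
    simp only [List.length_map, List.length_range] at hi
    have h1 : i < v.length + 1 - c := by omega
    obtain ⟨w, rfl⟩ := huv
    simp only [List.length_append] at h1
    have h2 : i + c - u.length = 0 := by omega
    simp [h1, List.take_append, h2]
  · intro p q hq m
    obtain rfl := Part.mem_some_iff.1 hq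
    refine ⟨m + c, ?_⟩
    have : m < m + c + 1 - c := by omega
    simp only [List.getElem?_map, length_initSeg, List.getElem?_range this, Option.map_some]
    rw [List.take_of_length_le (by rw [length_initSeg])]
    rfl

theorem reducible_of_prefixFunctional {f g : Problem} {G G' : List ℕ → ℕ} (hG : Primrec G)
    (hG' : Primrec G') (c c' : ℕ)
    (h : ∀ x ∈ g.dom, prefixFunctional G c x ∈ f.dom ∧ ∀ y ∈ f (prefixFunctional G c x),
      prefixFunctional G' c' (pairing y x) ∈ g x) : Reducible g f := by
  refine ⟨_, _, computableFunctional_prefixFunctional hG c,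
    computableFunctional_prefixFunctional hG' c', fun F hF x hx => ?_⟩
  obtain ⟨hd, hs⟩ := h x hx
  obtain ⟨y, hy, hyf⟩ := hF _ hd
  refine ⟨_, ?_, hs y hyf⟩
  simp only [wrap, Part.bind_some, Part.mem_bind_iff]
  exact ⟨y, hy, Part.mem_some _⟩

theorem pairing_one (y x : Baire) : pairing y x 1 = x 0 := rfl

theorem pairing_two (y x : Baire) : pairing y x 2 = y 1 := rfl

/-! ### Finding a set on which all remaining colours recur -/

/-- The samples that lie in the test set `B`, if there are some and they show fewer colours than
all the given samples; otherwise all the samples. -/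
def narrow (B : ℕ → Bool) (L : List (ℕ × ℕ)) : List (ℕ × ℕ) :=
  if L.filter (fun z : ℕ × ℕ => B z.1) = [] ∨
      ∀ c ∈ L.map Prod.snd, ∃ d ∈ (L.filter fun z : ℕ × ℕ => B z.1).map Prod.snd, d = c
    then L else L.filter fun z : ℕ × ℕ => B z.1

/-- The first `s` points with their colours. -/
def samples (a : ℕ → ℕ) (s : ℕ) : List (ℕ × ℕ) := (List.range s).map fun m => (m, a m)

/-- The samples that are left after narrowing down to the first `n` test sets. -/
def narrowed (hit : ℕ → ℕ → Bool) (a : ℕ → ℕ) (s n : ℕ) : List (ℕ × ℕ) :=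
  (List.range n).foldl (fun L i => narrow (hit i) L) (samples a s)

/-- The colour of the first sample that survives the narrowing. -/
def guess (hit : ℕ → ℕ → Bool) (a : ℕ → ℕ) (s : ℕ) : ℕ :=
  (narrowed hit a (s + 1) (s + 1)).headI.2

open Classical in
/-- The set of points to which the narrowing converges. -/
noncomputable def limitSet (hit : ℕ → ℕ → Bool) (a : ℕ → ℕ) : ℕ → Set ℕ
  | 0 => Set.univ
  | n + 1 =>
    if limitSet hit a n ∩ {m | hit n m} = ∅ ∨
        a '' limitSet hit a n ⊆ a '' (limitSet hit a n ∩ {m | hit n m})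
      then limitSet hit a n else limitSet hit a n ∩ {m | hit n m}

variable {hit : ℕ → ℕ → Bool} {a : ℕ → ℕ}

theorem narrowed_succ (hit : ℕ → ℕ → Bool) (a : ℕ → ℕ) (s n : ℕ) :
    narrowed hit a s (n + 1) = narrow (hit n) (narrowed hit a s n) := by
  simp [narrowed, List.range_succ]

theorem narrow_subset (B : ℕ → Bool) (L : List (ℕ × ℕ)) : narrow B L ⊆ L := by
  unfold narrow
  split_ifs
  · exact List.Subset.refl L
  · exact List.filter_subset_self L

theorem narrow_ne_nil (B : ℕ → Bool) {L : List (ℕ × ℕ)} (h : L ≠ []) : narrow B L ≠ [] := by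
  unfold narrow
  split_ifs with hc
  · exact h
  · exact fun h' => hc (Or.inl h')

theorem narrowed_subset (s : ℕ) {m n : ℕ} (h : m ≤ n) :
    narrowed hit a s n ⊆ narrowed hit a s m := by
  induction n, h using Nat.le_induction with
  | base => exact List.Subset.refl _
  | succ n _ ih =>
    rw [narrowed_succ]
    exact List.Subset.trans (narrow_subset _ _) ih

theorem narrowed_ne_nil (s n : ℕ) : narrowed hit a (s + 1) n ≠ [] := by
  induction n with
  | zero => simp [narrowed, samples]
  | succ n ih =>
    rw [narrowed_succ]
    exact narrow_ne_nil _ ih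

theorem limitSet_nonempty (n : ℕ) : (limitSet hit a n).Nonempty := by
  induction n with
  | zero => exact Set.univ_nonempty
  | succ n ih =>
    unfold limitSet
    split_ifs with hc
    · exact ih
    · exact Set.nonempty_iff_ne_empty.2 fun h => hc (Or.inl h)

/-- One witness per colour suffices, and there are finitely many colours. -/
theorem eventually_colours_seen (ha : (Set.range a).Finite) (Y : Set ℕ) :
    ∀ᶠ s in atTop, ∀ j ∈ Y, ∃ i ∈ Y, i < s ∧ a i = a j := by
  have hf : (a '' Y).Finite := ha.subset (Set.image_subset_range a Y)
  have : ∀ c ∈ a '' Y, ∀ᶠ s in atTop, ∃ i ∈ Y, i < s ∧ a i = c := by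
    rintro c ⟨i, hi, rfl⟩
    filter_upwards [eventually_gt_atTop i] with s hs
    exact ⟨i, hi, hs, rfl⟩
  filter_upwards [(eventually_all_finite hf).2 this] with s hs j hj
  exact hs _ ⟨j, hj, rfl⟩

-- The stage `n` is fixed while `s` grows: a large sample answers each of finitely many tests as the
-- full set would. The bound on `s` depends on `n` and is not computed.
open Classical in
theorem eventually_narrowed_eq (ha : (Set.range a).Finite) (n : ℕ) :
    ∀ᶠ s in atTop, narrowed hit a s n =
      (samples a s).filter fun z => decide (z.1 ∈ limitSet hit a n) := by
  induction n with
  | zero => simp [narrowed, limitSet]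
  | succ n ih =>
    set X := limitSet hit a n with hX
    obtain ⟨Y, hY⟩ : ∃ Y, Y = X ∩ {m | hit n m} := ⟨_, rfl⟩
    -- Once all colours of both sets are sampled, the list test and the set test agree; in
    -- particular a nonempty `Y` has a sampled point.
    filter_upwards [ih, eventually_colours_seen ha X,
      eventually_colours_seen ha Y] with s hs h1 h2
    have hfilter : ((samples a s).filter fun z => decide (z.1 ∈ X)).filter (fun z => hit n z.1) =
        (samples a s).filter fun z => decide (z.1 ∈ Y) := by
      rw [List.filter_filter]
      congr 1
      ext z
      simp [hY, and_comm]
    have hmem : ∀ Y : Set ℕ, ∀ z : ℕ × ℕ,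
        z ∈ ((samples a s).filter fun z => decide (z.1 ∈ Y)) ↔
          z.1 ∈ Y ∧ z.1 < s ∧ a z.1 = z.2 := by
      rintro Y ⟨m, c⟩
      simp only [samples, List.mem_filter, List.mem_map, List.mem_range, Prod.mk.injEq,
        decide_eq_true_eq]
      constructor
      · rintro ⟨⟨i, hi, rfl, rfl⟩, hm⟩
        exact ⟨hm, hi, rfl⟩
      · rintro ⟨hm, hi, rfl⟩
        exact ⟨⟨m, hi, rfl, rfl⟩, hm⟩
    rw [narrowed_succ, hs, narrow, hfilter, limitSet, ← hX, ← hY]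
    have hcond : ((samples a s).filter (fun z => decide (z.1 ∈ Y)) = [] ∨
        ∀ c ∈ ((samples a s).filter fun z => decide (z.1 ∈ X)).map Prod.snd,
          ∃ d ∈ ((samples a s).filter
            fun z => decide (z.1 ∈ Y)).map Prod.snd, d = c) ↔
        (Y = ∅ ∨ a '' X ⊆ a '' Y) := by
      apply or_congr
      · rw [List.eq_nil_iff_forall_not_mem, Set.eq_empty_iff_forall_notMem]
        constructor
        · intro h j hj
          obtain ⟨i, hi, his, -⟩ := h2 j hj
          exact h (i, a i) ((hmem _ _).2 ⟨hi, his, rfl⟩)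
        · intro h z hz
          exact h _ ((hmem _ _).1 hz).1
      · constructor
        · rintro h _ ⟨j, hj, rfl⟩
          obtain ⟨i, hi, his, hij⟩ := h1 j hj
          obtain ⟨d, hd, hdj⟩ := h (a j)
            (List.mem_map.2 ⟨(i, a j), (hmem _ _).2 ⟨hi, his, hij⟩, rfl⟩)
          obtain ⟨z, hz, rfl⟩ := List.mem_map.1 hd
          obtain ⟨hz1, -, hz2⟩ := (hmem _ _).1 hz
          exact ⟨z.1, hz1, hz2.trans hdj⟩
        · intro h c hc
          obtain ⟨z, hz, rfl⟩ := List.mem_map.1 hc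
          obtain ⟨hz1, -, hz2⟩ := (hmem _ _).1 hz
          obtain ⟨j, hj, hjz⟩ := h ⟨z.1, hz1, rfl⟩
          obtain ⟨i, hi, his, hij⟩ := h2 j hj
          exact ⟨_, List.mem_map.2 ⟨(i, z.2),
            (hmem _ _).2 ⟨hi, his, hij.trans (hjz.trans hz2)⟩, rfl⟩, rfl⟩
    by_cases hc : Y = ∅ ∨ a '' X ⊆ a '' Y
    · rw [if_pos (hcond.2 hc), if_pos hc]
    · rw [if_neg (fun h => hc (hcond.1 h)), if_neg hc]

theorem limitSet_succ_eq_or (n : ℕ) : limitSet hit a (n + 1) = limitSet hit a n ∨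
    a '' limitSet hit a (n + 1) ⊂ a '' limitSet hit a n := by
  rw [limitSet]
  split_ifs with hc
  · exact Or.inl rfl
  · push Not at hc
    exact Or.inr ⟨Set.image_mono Set.inter_subset_left, hc.2⟩

theorem exists_limitSet_stable (ha : (Set.range a).Finite) :
    ∃ N, ∀ n, N ≤ n → limitSet hit a n = limitSet hit a N := by
  have hfin : ∀ n, (a '' limitSet hit a n).Finite :=
    fun n => ha.subset (Set.image_subset_range _ _)
  -- A stage with the fewest colours: a later change would lose another one.
  obtain ⟨N, hN⟩ := WellFounded.has_min (measure fun n => (a '' limitSet hit a n).ncard).wf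
    Set.univ ⟨0, trivial⟩
  refine ⟨N, fun n hn => ?_⟩
  induction n, hn using Nat.le_induction with
  | base => rfl
  | succ n _ ih =>
    rcases limitSet_succ_eq_or (hit := hit) (a := a) n with h | h
    · exact h.trans ih
    · rw [ih] at h
      exact absurd (Set.ncard_lt_ncard h (hfin N)) (hN.2 (n + 1) trivial)

/-- The limit set keeps all its colours in every later test set that meets it, and the guesses
are eventually colours of the limit set. -/
theorem exists_limitSet_recurrent (ha : (Set.range a).Finite) :
    ∃ N, (∀ n, N ≤ n → (∃ m ∈ limitSet hit a N, hit n m) → ∀ i ∈ limitSet hit a N,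
        ∃ j ∈ limitSet hit a N, hit n j ∧ a j = a i) ∧
      ∀ᶠ s in atTop, ∃ i ∈ limitSet hit a N, guess hit a s = a i := by
  obtain ⟨N, hN⟩ := exists_limitSet_stable (hit := hit) ha
  refine ⟨N, ?_, ?_⟩
  · rintro n hn ⟨m, hm, hnm⟩ i hi
    have h := hN (n + 1) (by omega)
    rw [limitSet, hN n hn] at h
    split_ifs at h with hc
    · rcases hc with hc | hc
      · exact absurd (show m ∈ limitSet hit a N ∩ {m | hit n m} from ⟨hm, hnm⟩)
          (hc ▸ Set.notMem_empty m)
      · obtain ⟨j, ⟨hj, hnj⟩, hji⟩ := hc ⟨i, hi, rfl⟩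
        exact ⟨j, hj, hnj, hji⟩
    · rw [← h] at hi
      exact ⟨i, hi.1, hi.2, rfl⟩
  · have h := (tendsto_add_atTop_nat 1).eventually (eventually_narrowed_eq (hit := hit) ha N)
    filter_upwards [h, eventually_ge_atTop N] with s hs hsN
    obtain ⟨z, l, hzl⟩ :=
      List.exists_cons_of_ne_nil (narrowed_ne_nil (hit := hit) (a := a) s (s + 1))
    -- Tests after stage `N` may be answered wrongly on the finite sample, but they only remove
    -- samples, so the survivor still lies in the limit set.
    have hz : z ∈ narrowed hit a (s + 1) N :=
      narrowed_subset _ (by omega : N ≤ s + 1) (hzl ▸ List.mem_cons_self)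
    rw [hs] at hz
    simp only [samples, List.mem_filter, List.mem_map, decide_eq_true_eq] at hz
    obtain ⟨⟨i, -, rfl⟩, hi⟩ := hz
    exact ⟨i, hi, by simp [guess, hzl]⟩

/-! ### Computability of the guesses -/

theorem primrec_narrow {hit : ℕ → ℕ → Bool} (h : Primrec₂ hit) :
    Primrec₂ fun (L : List (ℕ × ℕ)) (i : ℕ) => narrow (hit i) L := by
  have hf : Primrec₂ fun (L : List (ℕ × ℕ)) (i : ℕ) => L.filter fun z => hit i z.1 := by
    have hR : PrimrecRel fun (z : ℕ × ℕ) (i : ℕ) => hit i z.1 = true :=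
      Primrec.eq.comp (h.comp Primrec.snd (Primrec.fst.comp Primrec.fst)) (Primrec.const true)
    exact (hR.listFilter).of_eq fun L i => by simp
  -- Membership is written as a bounded list quantifier, the form that closure of primitive
  -- recursive relations handles.
  have hmem : PrimrecRel fun (M : List ℕ) (c : ℕ) => ∃ d ∈ M, d = c :=
    PrimrecRel.exists_mem_list Primrec.eq
  have hall : PrimrecRel fun (M M' : List ℕ) => ∀ c ∈ M, ∃ d ∈ M', d = c :=
    PrimrecRel.forall_mem_list (R := fun c M' => ∃ d ∈ M', d = c)
      (hmem.comp Primrec.snd Primrec.fst)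
  have hsnd : Primrec fun L : List (ℕ × ℕ) => L.map Prod.snd :=
    Primrec.list_map Primrec.id (Primrec.snd.comp Primrec.snd)
  unfold narrow
  refine Primrec.ite (PrimrecPred.or ?_ ?_) Primrec.fst hf
  · exact Primrec.eq.comp hf (Primrec.const [])
  · exact hall.comp (hsnd.comp Primrec.fst) (hsnd.comp hf)

/-- The guess computed from a word whose first entry is a number of colours and whose other
entries are colours. -/
def guessWord (hit : ℕ → ℕ → Bool) (w : List ℕ) : ℕ :=
  ((List.range (w.length - 1)).foldl (fun L i => narrow (hit i) L)
    ((List.range (w.length - 1)).map fun m => (m, w.getD (m + 1) 0))).headI.2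

theorem primrec_guessWord {hit : ℕ → ℕ → Bool} (h : Primrec₂ hit) :
    Primrec (guessWord hit) := by
  have hr : Primrec fun w : List ℕ => List.range (w.length - 1) :=
    Primrec.list_range.comp (Primrec.pred.comp Primrec.list_length)
  have hm : Primrec₂ fun (w : List ℕ) (m : ℕ) => (m, w.getD (m + 1) 0) :=
    Primrec.pair Primrec.snd
      ((Primrec.list_getD 0).comp Primrec.fst (Primrec.succ.comp Primrec.snd))
  have hn : Primrec₂ fun (_ : List ℕ) (z : List (ℕ × ℕ) × ℕ) => narrow (hit z.2) z.1 :=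
    (primrec_narrow h).comp (Primrec.fst.comp Primrec.snd) (Primrec.snd.comp Primrec.snd)
  exact Primrec.snd.comp
    (Primrec.list_headI.comp (Primrec.list_foldl hr (Primrec.list_map hr hm) hn))

theorem guessWord_initSeg (hit : ℕ → ℕ → Bool) (p : Baire) (s : ℕ) :
    guessWord hit (initSeg p (s + 2)) = guess hit (tail p) s := by
  have : ((List.range (s + 1)).map fun m => (m, (initSeg p (s + 2)).getD (m + 1) 0)) =
      samples (tail p) (s + 1) := by
    apply List.map_congr_left
    intro m hm
    rw [List.mem_range] at hm
    rw [getD_initSeg p (by omega)]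
    rfl
  rw [guessWord, length_initSeg, Nat.add_sub_assoc (by omega), this]
  rfl

/-- Early guesses may be wrong, but they must still be legal colours for the guesses to form an
input of `cRT`. -/
theorem guess_mem_range (hit : ℕ → ℕ → Bool) (a : ℕ → ℕ) (s : ℕ) :
    guess hit a s ∈ Set.range a := by
  obtain ⟨z, l, hzl⟩ :=
    List.exists_cons_of_ne_nil (narrowed_ne_nil (hit := hit) (a := a) s (s + 1))
  have hz : z ∈ narrowed hit a (s + 1) 0 :=
    narrowed_subset _ (Nat.zero_le (s + 1)) (hzl ▸ List.mem_cons_self)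
  simp only [narrowed, samples, List.range_zero, List.foldl_nil, List.mem_map] at hz
  obtain ⟨i, -, rfl⟩ := hz
  exact ⟨i, by simp [guess, hzl]⟩

/-! ### The enumeration of the rationals -/

theorem ratEnum_surjective : Function.Surjective ratEnum := by
  intro q
  refine ⟨Nat.pair (Nat.pair q.num.toNat (-q.num).toNat) (q.den - 1), ?_⟩
  have h1 : ((q.num.toNat : ℚ) - ((-q.num).toNat : ℚ)) = q.num := by
    have : (q.num.toNat : ℤ) - ((-q.num).toNat : ℤ) = q.num := by omega
    exact_mod_cast this
  have h2 : ((q.den - 1 : ℕ) : ℚ) + 1 = q.den := by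
    have := q.den_pos
    exact_mod_cast (by omega : q.den - 1 + 1 = q.den)
  simp only [ratEnum, Nat.unpair_pair, h1, h2]
  exact Rat.num_div_den q

theorem primrecRel_ratEnum_lt : PrimrecRel fun m n : ℕ => ratEnum m < ratEnum n := by
  have hn : Primrec fun n : ℕ => n.unpair.1.unpair.1 :=
    Primrec.fst.comp (Primrec.unpair.comp (Primrec.fst.comp Primrec.unpair))
  have hs : Primrec fun n : ℕ => n.unpair.1.unpair.2 :=
    Primrec.snd.comp (Primrec.unpair.comp (Primrec.fst.comp Primrec.unpair))
  have hd : Primrec fun n : ℕ => n.unpair.2 + 1 :=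
    Primrec.succ.comp (Primrec.snd.comp Primrec.unpair)
  have hcross : Primrec₂ fun m n : ℕ => m.unpair.1.unpair.1 * (n.unpair.2 + 1) +
      n.unpair.1.unpair.2 * (m.unpair.2 + 1) :=
    Primrec.nat_add.comp
      (Primrec.nat_mul.comp (hn.comp Primrec.fst) (hd.comp Primrec.snd))
      (Primrec.nat_mul.comp (hs.comp Primrec.snd) (hd.comp Primrec.fst))
  refine PrimrecRel.of_eq (Primrec.nat_lt.comp₂ hcross hcross.swap) fun m n => ?_
  have h1 : (0 : ℚ) < (m.unpair.2 : ℚ) + 1 := by positivity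
  have h2 : (0 : ℚ) < (n.unpair.2 : ℚ) + 1 := by positivity
  rw [ratEnum, ratEnum, div_lt_div_iff₀ h1 h2, ← Nat.cast_lt (α := ℚ), Function.swap]
  push_cast
  constructor <;> intro h <;> linarith

theorem primrecRel_ratEnum_eq : PrimrecRel fun m n : ℕ => ratEnum m = ratEnum n :=
  (PrimrecRel.of_eq (PrimrecPred.and (PrimrecPred.not primrecRel_ratEnum_lt)
    (PrimrecPred.not (primrecRel_ratEnum_lt.comp Primrec.snd Primrec.fst))).primrecRel
    fun m n => by simp only [not_lt]; exact ⟨fun h => le_antisymm h.2 h.1, fun h => ⟨h.ge, h.le⟩⟩)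

/-- The rational with index `m` lies in the interval coded by `n`; every interval has arbitrarily
large codes. -/
def hitsInterval (n m : ℕ) : Bool :=
  decide (ratEnum n.unpair.2.unpair.1 < ratEnum m ∧ ratEnum m < ratEnum n.unpair.2.unpair.2)

theorem primrec_hitsInterval : Primrec₂ hitsInterval := by
  have hu : Primrec fun n : ℕ × ℕ => n.1.unpair.2.unpair :=
    Primrec.unpair.comp (Primrec.snd.comp (Primrec.unpair.comp Primrec.fst))
  exact PrimrecPred.decide
    ((primrecRel_ratEnum_lt.comp (Primrec.fst.comp hu) Primrec.snd).and
      (primrecRel_ratEnum_lt.comp Primrec.snd (Primrec.snd.comp hu)))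

theorem exists_hitsInterval (N : ℕ) (x y : ℚ) : ∃ n, N ≤ n ∧
    ∀ m, hitsInterval n m = true ↔ x < ratEnum m ∧ ratEnum m < y := by
  obtain ⟨i, rfl⟩ := ratEnum_surjective x
  obtain ⟨j, rfl⟩ := ratEnum_surjective y
  -- The first component is padding that the test ignores.
  exact ⟨Nat.pair N (Nat.pair i j), Nat.left_le_pair _ _, fun m => by simp [hitsInterval]⟩

theorem limitSet_hitsInterval (a : ℕ → ℕ) (n : ℕ) :
    ∃ U : Set ℚ, IsOpen U ∧ limitSet hitsInterval a n = ratEnum ⁻¹' U := by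
  induction n with
  | zero => exact ⟨Set.univ, isOpen_univ, rfl⟩
  | succ n ih =>
    obtain ⟨U, hU, hX⟩ := ih
    rw [limitSet]
    split_ifs
    · exact ⟨U, hU, hX⟩
    · refine ⟨U ∩ Set.Ioo (ratEnum n.unpair.2.unpair.1) (ratEnum n.unpair.2.unpair.2),
        hU.inter isOpen_Ioo, ?_⟩
      rw [hX]
      ext m
      simp [hitsInterval]

theorem eventually_occursDensely {p : Baire} {k : ℕ} {α : ℚ → Fin k}
    (hp : NamesColouring p k α) : ∀ᶠ s in atTop, ∃ c : Fin k,
      guess hitsInterval (tail p) s = c ∧ ∃ u v : ℚ, u < v ∧ OccursDensely α c u v := by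
  have hfin : (Set.range (tail p)).Finite := by
    refine (Set.finite_lt_nat k).subset ?_
    rintro _ ⟨n, rfl⟩
    rw [hp.2]
    exact (α _).2
  obtain ⟨N, hN, hs⟩ := exists_limitSet_recurrent (hit := hitsInterval) hfin
  obtain ⟨U, hU, hX⟩ := limitSet_hitsInterval (tail p) N
  obtain ⟨m, hm⟩ := limitSet_nonempty (hit := hitsInterval) (a := tail p) N
  rw [hX] at hm
  obtain ⟨u, v, ⟨hu, hv⟩, huv⟩ := mem_nhds_iff_exists_Ioo_subset.1 (hU.mem_nhds hm)
  filter_upwards [hs] with s hs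
  obtain ⟨i, hi, hsi⟩ := hs
  refine ⟨α (ratEnum i), hsi.trans (hp.2 i), u, v, hu.trans hv, fun x hx y hy hxy => ?_⟩
  -- Recurrence holds only for tests from `N` on, so a late code of the interval is needed.
  obtain ⟨n, hn, hxyn⟩ := exists_hitsInterval N x y
  obtain ⟨z, hxz, hzy⟩ := exists_between hxy
  obtain ⟨l, rfl⟩ := ratEnum_surjective z
  obtain ⟨j, -, hj, hji⟩ := hN n hn
    ⟨l, hX ▸ huv ⟨hx.1.trans hxz, hzy.trans hy.2⟩, (hxyn l).2 ⟨hxz, hzy⟩⟩ i hi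
  obtain ⟨h1, h2⟩ := (hxyn j).1 hj
  refine ⟨ratEnum j, h1, h2, Fin.ext ?_⟩
  rw [← hp.2, ← hp.2, hji]

theorem mem_dom_cEta {p : Baire} {k : ℕ} {α : ℚ → Fin k} (hp : NamesColouring p k α) :
    p ∈ cEta.dom := by
  obtain ⟨_, c, -, hc⟩ := (eventually_occursDensely hp).exists
  exact ⟨fun _ => c, k, α, hp, c, rfl, hc⟩

theorem mem_dom_cRT {p : Baire} {k : ℕ} (hp : ∀ n, p n < k) : p ∈ (cRT k).dom := by
  obtain ⟨j, hj⟩ := Finite.exists_infinite_fiber fun n => (⟨p n, hp n⟩ : Fin k)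
  refine ⟨fun _ => j, hp, j.2, ?_⟩
  convert Set.infinite_coe_iff.1 hj using 1
  ext n
  simp [Fin.ext_iff]

theorem guess_mem_dom_cRT {p : Baire} {k : ℕ} {α : ℚ → Fin k} (hp : NamesColouring p k α) :
    guess hitsInterval (tail p) ∈ (cRT k).dom := by
  refine mem_dom_cRT fun s => ?_
  obtain ⟨n, hn⟩ := guess_mem_range hitsInterval (tail p) s
  rw [← hn, hp.2]
  exact (α _).2

theorem mem_cEta_of_infinite {p : Baire} {k : ℕ} {α : ℚ → Fin k} (hp : NamesColouring p k α)
    {r : Baire} (hr : {s | guess hitsInterval (tail p) s = r 0}.Infinite) : r ∈ cEta p := by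
  obtain ⟨s, hs, c, hc, h⟩ :=
    ((Nat.frequently_atTop_iff_infinite.2 hr).and_eventually (eventually_occursDensely hp)).exists
  exact ⟨k, α, hp, c, (show _ = r 0 from hs).symm.trans hc, h⟩

/-! ### Colouring the rationals by their least indices -/

/-- The least index of a rational in the enumeration. -/
noncomputable def leastIndex (q : ℚ) : ℕ := Nat.find (ratEnum_surjective q)

theorem ratEnum_leastIndex (q : ℚ) : ratEnum (leastIndex q) = q :=
  Nat.find_spec (ratEnum_surjective q)

theorem leastIndex_injective : Function.Injective leastIndex :=
  Function.LeftInverse.injective ratEnum_leastIndex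

theorem leastIndex_ratEnum_le (n : ℕ) : leastIndex (ratEnum n) ≤ n :=
  Nat.find_min' (ratEnum_surjective (ratEnum n)) rfl

theorem primrec_leastIndex_ratEnum : Primrec fun n => leastIndex (ratEnum n) := by
  have h : Primrec fun n : ℕ =>
      (List.range (n + 1)).findIdx fun m => decide (ratEnum m = ratEnum n) :=
    Primrec.list_findIdx (Primrec.list_range.comp Primrec.succ)
      (PrimrecPred.decide (primrecRel_ratEnum_eq.comp Primrec.snd Primrec.fst))
  refine h.of_eq fun n => ?_
  have hle := leastIndex_ratEnum_le n
  rw [List.findIdx_eq (by simp; omega)]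
  refine ⟨by simp [ratEnum_leastIndex], fun j hj => ?_⟩
  simpa using Nat.find_min (ratEnum_surjective (ratEnum n)) hj

/-- The colouring of the rationals that gives `q` the colour `p (leastIndex q)`. -/
noncomputable def colouringOf {p : Baire} {k : ℕ} (hp : ∀ n, p n < k) (q : ℚ) : Fin k :=
  ⟨p (leastIndex q), hp _⟩

/-- Removing finitely many points from an interval leaves a nonempty open set, which would contain
an interval free of the colour. -/
theorem infinite_of_occursDensely {k : ℕ} {α : ℚ → Fin k} {c : Fin k} {u v : ℚ} (huv : u < v)
    (h : OccursDensely α c u v) : {q | α q = c}.Infinite := by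
  intro hfin
  obtain ⟨z, hz, hzc⟩ := ((Set.Ioo_infinite huv).sdiff hfin).nonempty
  have hopen : IsOpen (Set.Ioo u v \ {q | α q = c}) := isOpen_Ioo.sdiff hfin.isClosed
  obtain ⟨x, y, ⟨hx, hy⟩, hxy⟩ := mem_nhds_iff_exists_Ioo_subset.1 (hopen.mem_nhds ⟨hz, hzc⟩)
  obtain ⟨x', hx1, hx2⟩ := exists_between hx
  obtain ⟨y', hy1, hy2⟩ := exists_between hy
  obtain ⟨q, hq1, hq2, hq⟩ := h x' (hxy ⟨hx1, hx2.trans hy⟩).1 y'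
    (hxy ⟨hx.trans hy1, hy2⟩).1 (hx2.trans hy1)
  exact (hxy ⟨hx1.trans hq1, hq2.trans hy2⟩).2 hq

theorem infinite_of_mem_cEta {p q : Baire} {k : ℕ} (h0 : q 0 = k)
    (hq : ∀ n, q (n + 1) = p (leastIndex (ratEnum n))) {r : Baire} (hr : r ∈ cEta q) :
    r 0 < k ∧ {n | p n = r 0}.Infinite := by
  obtain ⟨k', α, ⟨hk, hα⟩, c, hc, u, v, huv, hd⟩ := hr
  obtain rfl : k = k' := h0.symm.trans hk
  refine ⟨hc ▸ c.2, ?_⟩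
  refine ((infinite_of_occursDensely huv hd).image leastIndex_injective.injOn).mono ?_
  rintro _ ⟨z, hz, rfl⟩
  have h := hα (leastIndex z)
  rw [ratEnum_leastIndex, show α z = c from hz] at h
  rw [Set.mem_ofPred_eq, hc, ← h, tail, hq, ratEnum_leastIndex]

theorem namesColouring_colouringOf {p q : Baire} {k : ℕ} (hp : ∀ n, p n < k) (h0 : q 0 = k)
    (hq : ∀ n, q (n + 1) = p (leastIndex (ratEnum n))) :
    NamesColouring q k (colouringOf hp) :=
  ⟨h0, hq⟩

/-! ### The reductions -/

theorem primrec_getD (i : ℕ) : Primrec fun w : List ℕ => w.getD i 0 :=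
  (Primrec.list_getD 0).comp Primrec.id (Primrec.const i)

theorem primrecPred_length_le (i : ℕ) : PrimrecPred fun w : List ℕ => w.length ≤ i :=
  Primrec.nat_le.comp Primrec.list_length (Primrec.const i)

theorem cEtaRestrict_reducible_cRT (k : ℕ) : Reducible (cEtaRestrict k) (cRT k) := by
  -- Guess `s` reads the number of colours and `s + 1` colours, hence the offset 2.
  refine reducible_of_prefixFunctional (primrec_guessWord primrec_hitsInterval) (primrec_getD 0)
    2 1 ?_
  rintro p ⟨_, rfl, k, α, hp, -⟩
  have hG : prefixFunctional (guessWord hitsInterval) 2 p = guess hitsInterval (tail p) :=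
    funext fun s => guessWord_initSeg hitsInterval p s
  rw [hG, hp.1]
  refine ⟨guess_mem_dom_cRT hp, ?_⟩
  rintro y ⟨-, -, hy⟩
  refine ⟨hp.1, mem_cEta_of_infinite hp ?_⟩
  rwa [prefixFunctional, getD_initSeg _ (by omega)]

theorem cEta_reducible_cRTPlus : Reducible cEta cRTPlus := by
  -- A word of length 1 yields output 0, the copied number of colours. The answer is entry 1 of `y`,
  -- so entry 2 of the pairing.
  refine reducible_of_prefixFunctional
    (Primrec.ite (primrecPred_length_le 1) (primrec_getD 0)
      (primrec_guessWord primrec_hitsInterval)) (primrec_getD 2) 1 3 ?_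
  rintro p ⟨_, k, α, hp, -⟩
  set q := prefixFunctional
    (fun w => if w.length ≤ 1 then w.getD 0 0 else guessWord hitsInterval w) 1 p with hq
  have h0 : q 0 = k := by simp [hq, prefixFunctional, initSeg, hp.1]
  have ht : tail q = guess hitsInterval (tail p) := by
    funext s
    simp [hq, tail, prefixFunctional, length_initSeg, guessWord_initSeg]
  constructor
  · obtain ⟨r, hr⟩ := guess_mem_dom_cRT hp
    refine ⟨fun n => Nat.casesOn n k r, ?_, h0.symm, ?_⟩
    -- The colour of 0 shows that `k` is positive.
    · rw [Set.mem_ofPred_eq, h0]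
      exact (α 0).pos
    · rw [h0, ht]
      exact hr
  · rintro y ⟨-, -, -, -, hy⟩
    refine mem_cEta_of_infinite hp ?_
    rw [ht] at hy
    rwa [prefixFunctional, getD_initSeg _ (by omega), pairing_two]

theorem cRT_reducible_cEtaRestrict (k : ℕ) : Reducible (cRT k) (cEtaRestrict k) := by
  refine reducible_of_prefixFunctional
    (Primrec.ite (primrecPred_length_le 1) (Primrec.const k)
      ((Primrec.list_getD 0).comp Primrec.id (primrec_leastIndex_ratEnum.comp
        (Primrec.nat_sub.comp Primrec.list_length (Primrec.const 2))))) (primrec_getD 0) 1 1 ?_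
  rintro p ⟨_, hp, -⟩
  set q := prefixFunctional (fun w => if w.length ≤ 1 then k else
    w.getD (leastIndex (ratEnum (w.length - 2))) 0) 1 p with hqd
  have h0 : q 0 = k := by simp [hqd, prefixFunctional, initSeg]
  have hq : ∀ n, q (n + 1) = p (leastIndex (ratEnum n)) := by
    intro n
    -- This bound keeps the queried entry inside the prefix of length `n + 2`.
    have := leastIndex_ratEnum_le n
    rw [hqd, prefixFunctional, length_initSeg, if_neg (by omega),
      Nat.add_sub_cancel (n := n) (m := 2), getD_initSeg _ (by omega)]
  constructor
  · obtain ⟨r, hr⟩ := mem_dom_cEta (namesColouring_colouringOf hp h0 hq)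
    exact ⟨r, h0, hr⟩
  · rintro y ⟨-, hy⟩
    refine ⟨hp, ?_⟩
    rw [prefixFunctional, getD_initSeg _ (by omega)]
    exact infinite_of_mem_cEta h0 hq hy

theorem cRTPlus_reducible_cEta : Reducible cRTPlus cEta := by
  refine reducible_of_prefixFunctional
    -- The successor skips the leading number of colours in `p`. On the way back, output 0 is that
    -- number, at entry 1 of the pairing; all later outputs repeat the colour, at entry 0.
    (Primrec.ite (primrecPred_length_le 1) (primrec_getD 0)
      ((Primrec.list_getD 0).comp Primrec.id (Primrec.succ.comp (primrec_leastIndex_ratEnum.comp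
        (Primrec.nat_sub.comp Primrec.list_length (Primrec.const 2))))))
    (Primrec.ite (primrecPred_length_le 2) (primrec_getD 1) (primrec_getD 0)) 1 2 ?_
  rintro p ⟨_, hk, -, hp, -⟩
  set q := prefixFunctional (fun w => if w.length ≤ 1 then w.getD 0 0 else
    w.getD (leastIndex (ratEnum (w.length - 2)) + 1) 0) 1 p with hqd
  have h0 : q 0 = p 0 := by simp [hqd, prefixFunctional, initSeg]
  have hq : ∀ n, q (n + 1) = tail p (leastIndex (ratEnum n)) := by
    intro n
    have := leastIndex_ratEnum_le n
    rw [hqd, prefixFunctional, length_initSeg, if_neg (by omega),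
      Nat.add_sub_cancel (n := n) (m := 2), getD_initSeg _ (by omega)]
    rfl
  refine ⟨mem_dom_cEta (namesColouring_colouringOf hp h0 hq), fun y hy => ⟨hk, ?_, hp, ?_⟩⟩
  · simp [prefixFunctional, initSeg, List.range_succ, pairing_one]
  · rw [tail, prefixFunctional, length_initSeg, if_neg (by omega), getD_initSeg _ (by omega)]
    exact infinite_of_mem_cEta h0 hq hy

end Weihrauch

theorem mainTheorem7 :
    (∀ k : ℕ, Weihrauch.Equivalent (Weihrauch.cEtaRestrict k) (Weihrauch.cRT k)) ∧
      Weihrauch.Equivalent Weihrauch.cEta Weihrauch.cRTPlus :=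
  ⟨fun k => ⟨Weihrauch.cEtaRestrict_reducible_cRT k, Weihrauch.cRT_reducible_cEtaRestrict k⟩,
    Weihrauch.cEta_reducible_cRTPlus, Weihrauch.cRTPlus_reducible_cEta⟩
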